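/- Let $T>0$ and $k,n_1,n_2\in\mathbb{N}$, and equip $\mathbb{R}^k$ and $\mathbb{R}^{n_1\times n_2}$ with the Euclidean norm $|\cdot|$ (on matrices: the Frobenius norm). For $\rho_1,\rho_2\in C(\mathbb{R};\mathbb{R})$ and $m\in\mathbb{N}$, let $\mathcal{NN}^{\rho_1,\rho_2}_{m;1}$ be the set of deep feed-forward neural networks $\varphi=w_L\circ\sigma_{L-1}\circ w_{L-1}\circ\cdots\circ\sigma_1\circ w_1\colon\mathbb{R}^m\to\mathbb{R}$ with arbitrary depth $L\ge 1$, arbitrary positive widths $N_1,\dots,N_{L-1}$ of the hidden layers (and $N_0=m$, $N_L=1$), affine maps $w_l\colon\mathbb{R}^{N_{l-1}}\to\mathbb{R}^{N_l}$, $x\mapsto A_lx+b_l$, and activation functions $\sigma_l\in\{\rho_1,\rho_2\}$ applied componentwise. Let $\mathcal{NN}^{\rho_1,\rho_2}_{k+1;n_1,n_2}$ be the set of functions $\varphi=(\varphi^{ij})_{i\le n_1,\,j\le n_2}$ with all $\varphi^{ij}\in\mathcal{NN}^{\rho_1,\rho_2}_{k+1;1}$, restricted to $[0,T]\times\mathbb{R}^k\subset\mathbb{R}^{k+1}$.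 A set $\mathcal{N}\subset C([0,T]\times\mathbb{R}^k;\mathbb{R}^{n_1\times n_2})$ has the *universal approximation property under a linear growth constraint* if for every $f\in C([0,T]\times\mathbb{R}^k;\mathbb{R}^{n_1\times n_2})$ for which there is a constant $C_f>0$ with $$|f(t,x)|\le C_f(1+|x|),\qquad t\in[0,T],\ x\in\mathbb{R}^k,$$ there is a constant $\widetilde C_f>0$ such that for every $\epsilon\in(0,1)$ and every compact set $K\subset\mathbb{R}^k$ there exists $\varphi\in\mathcal{N}$ with $$\sup_{(t,x)\in[0,T]\times K}|\varphi(t,x)-f(t,x)|\le\epsilon\qquad\text{and}\qquad|\varphi(t,x)|\le\widetilde C_f(1+|x|),\quad t\in[0,T],\ x\in\mathbb{R}^k.$$ **Proposition.** Let $\rho_1\colon\mathbb{R}\to\mathbb{R}$ be continuous, non-affine, and continuously differentiable at at least one point with non-zero derivative at that point (that is, for some $x_0$, $\rho_1$ is differentiable in a neighbourhood of $x_0$, $\rho_1'$ is continuous at $x_0$, and $\rho_1'(x_0)\ne0$), and let $\rho_2(x)=\max(x,0)$ be the ReLU activation function. Then $\mathcal{NN}^{\rho_1,\rho_2}_{k+1;n_1,n_2}$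 has the universal approximation property under a linear growth constraint. Moreover, for every $f$ and every $C_f>0$ as above, the constant $\widetilde C_f$ can be chosen to be $\widetilde C_f=\sqrt{n_1n_2}\,(1+T)(1+C_f)$. -/

import Mathlib

open Topology

-- The Euclidean (Frobenius) norm is the norm on matrices.
attribute [local instance] Matrix.frobeniusNormedAddCommGroup

/-- The rectified linear unit. -/
noncomputable def relu (x : ℝ) : ℝ := max x 0

/-- `IsDeepNet ρ₁ ρ₂ φ`: the function `φ : ℝᵐ → ℝⁿ` is a deep feed-forward neural network
`w_L ∘ σ_{L-1} ∘ w_{L-1} ∘ ⋯ ∘ σ_1 ∘ w_1` with `L ≥ 1`, affine maps `w_l(x) = A_l x + b_l`,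
hidden layers of positive width, and activation functions `σ_l ∈ {ρ₁, ρ₂}` applied
componentwise. -/
inductive IsDeepNet (ρ₁ ρ₂ : ℝ → ℝ) :
    {m n : ℕ} → ((Fin m → ℝ) → (Fin n → ℝ)) → Prop
  | affine {m n : ℕ} (A : Matrix (Fin n) (Fin m) ℝ) (b : Fin n → ℝ) :
      IsDeepNet ρ₁ ρ₂ (fun x => A.mulVec x + b)
  | layer {m n p : ℕ} {φ : (Fin m → ℝ) → (Fin n → ℝ)} (hφ : IsDeepNet ρ₁ ρ₂ φ) (hn : 0 < n)
      (σ : ℝ → ℝ) (hσ : σ = ρ₁ ∨ σ = ρ₂)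
      (A : Matrix (Fin p) (Fin n) ℝ) (b : Fin p → ℝ) :
      IsDeepNet ρ₁ ρ₂ (fun x => A.mulVec (fun i => σ (φ x i)) + b)

/-- The space `C([0,T] × ℝᵏ; ℝ^{n₁ × n₂})`. -/
abbrev TimeSpaceFun (T : ℝ) (k n₁ n₂ : ℕ) : Type :=
  C(Set.Icc (0 : ℝ) T × EuclideanSpace ℝ (Fin k), Matrix (Fin n₁) (Fin n₂) ℝ)

/-- The functions on `[0,T] × ℝᵏ` all of whose matrix entries are (restrictions of) deep networks
`ℝ^{k+1} → ℝ` with activation functions `ρ₁` and `ρ₂`; the point `(t, x)` is read as the vector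
`(t, x_1, …, x_k)`. -/
def deepNets (ρ₁ ρ₂ : ℝ → ℝ) (T : ℝ) (k n₁ n₂ : ℕ) : Set (TimeSpaceFun T k n₁ n₂) :=
  {g | ∀ i j, ∃ φ : (Fin (k + 1) → ℝ) → (Fin 1 → ℝ), IsDeepNet ρ₁ ρ₂ φ ∧
    ∀ (t : Set.Icc (0 : ℝ) T) (x : EuclideanSpace ℝ (Fin k)),
      g (t, x) i j = φ (Fin.cons (t : ℝ) (fun l => x l)) 0}

/-- `|f(t,x)| ≤ C (1 + |x|)` on `[0,T] × ℝᵏ`. -/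
def LinearGrowth {T : ℝ} {k n₁ n₂ : ℕ} (f : TimeSpaceFun T k n₁ n₂) (C : ℝ) : Prop :=
  ∀ (t : Set.Icc (0 : ℝ) T) (x : EuclideanSpace ℝ (Fin k)), ‖f (t, x)‖ ≤ C * (1 + ‖x‖)

/-- For all `ε ∈ (0,1)` and compact `K`, the function `f` is approximated up to `ε`, uniformly on
`[0,T] × K`, by an element of `N` of linear growth with constant `C` (the same for all `ε`, `K`). -/
def ApproximableWith {T : ℝ} {k n₁ n₂ : ℕ} (N : Set (TimeSpaceFun T k n₁ n₂))
    (f : TimeSpaceFun T k n₁ n₂) (C : ℝ) : Prop :=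
  ∀ ε : ℝ, 0 < ε → ε < 1 → ∀ K : Set (EuclideanSpace ℝ (Fin k)), IsCompact K →
    ∃ φ ∈ N, (∀ (t : Set.Icc (0 : ℝ) T), ∀ x ∈ K, ‖φ (t, x) - f (t, x)‖ ≤ ε) ∧ LinearGrowth φ C

/-- The universal approximation property under a linear growth constraint. -/
def UniversalApproximationLG {T : ℝ} {k n₁ n₂ : ℕ} (N : Set (TimeSpaceFun T k n₁ n₂)) : Prop :=
  ∀ f : TimeSpaceFun T k n₁ n₂, (∃ C : ℝ, 0 < C ∧ LinearGrowth f C) →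
    ∃ C' : ℝ, 0 < C' ∧ ApproximableWith N f C'

/-! ### Networks and linear maps -/

namespace IsDeepNet

variable {ρ₁ ρ₂ : ℝ → ℝ}

/-! The approximants are ReLU networks. The functions generated from coordinates and constants by
linear combinations and `relu` form a vector lattice, and each is a network
(`ReluFun.exists_isDeepNet`). By the lattice Stone-Weierstrass theorem some such `g` is close to a
scalar `f` on `[0,T] × K`, but its growth off `K` depends on `ε` and `K`. The cure is to clamp `g`
to `±(C (1 + p) + 1)`, where the lattice function `p` satisfies `0 ≤ p ≤ |x|` everywhere and nearly
equals `|x|` on `K`. The clamp is inactive over `K` and gives the growth constant `1 + C`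
everywhere. Working entrywise costs the factor `√(n₁ n₂)`. -/

theorem layer_linearMap {m n p : ℕ} {φ : (Fin m → ℝ) → (Fin n → ℝ)}
    (hφ : IsDeepNet ρ₁ ρ₂ φ) (hn : 0 < n) {σ : ℝ → ℝ} (hσ : σ = ρ₁ ∨ σ = ρ₂)
    (L : (Fin n → ℝ) →ₗ[ℝ] (Fin p → ℝ)) (b : Fin p → ℝ) :
    IsDeepNet ρ₁ ρ₂ (fun x => L (fun i => σ (φ x i)) + b) := by
  have h := hφ.layer hn σ hσ (LinearMap.toMatrix' L) b
  simpa only [LinearMap.toMatrix'_mulVec] using h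

/-- A linear read-out is absorbed into the last affine map, so no activation is added. -/
theorem linearMap_comp {m n p : ℕ} {φ : (Fin m → ℝ) → (Fin n → ℝ)}
    (hφ : IsDeepNet ρ₁ ρ₂ φ) (L : (Fin n → ℝ) →ₗ[ℝ] (Fin p → ℝ)) (b : Fin p → ℝ) :
    IsDeepNet ρ₁ ρ₂ (fun x => L (φ x) + b) := by
  cases hφ with
  | affine A c =>
    have h := IsDeepNet.affine (ρ₁ := ρ₁) (ρ₂ := ρ₂) (LinearMap.toMatrix' L * A) (L c + b)
    simpa only [← Matrix.mulVec_mulVec, LinearMap.toMatrix'_mulVec, map_add, add_assoc] using h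
  | layer hψ hn σ hσ A c =>
    have h := hψ.layer hn σ hσ (LinearMap.toMatrix' L * A) (L c + b)
    simpa only [← Matrix.mulVec_mulVec, LinearMap.toMatrix'_mulVec, map_add, add_assoc] using h

end IsDeepNet

/-! ### Continuous piecewise affine functions generated by the rectified linear unit -/

/-- The functions generated from coordinates and constants by linear combinations and `relu`. -/
inductive ReluFun (m : ℕ) : ((Fin m → ℝ) → ℝ) → Prop
  | coord (i : Fin m) : ReluFun m (fun v => v i)
  | const (c : ℝ) : ReluFun m (fun _ => c)
  | add {f g : (Fin m → ℝ) → ℝ} (hf : ReluFun m f) (hg : ReluFun m g) :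
      ReluFun m (fun v => f v + g v)
  | smul {f : (Fin m → ℝ) → ℝ} (c : ℝ) (hf : ReluFun m f) : ReluFun m (fun v => c * f v)
  | relu {f : (Fin m → ℝ) → ℝ} (hf : ReluFun m f) : ReluFun m (fun v => relu (f v))

namespace ReluFun

variable {m : ℕ} {f g : (Fin m → ℝ) → ℝ}

theorem neg (hf : ReluFun m f) : ReluFun m (fun v => -f v) := by
  simpa using hf.smul (-1)

theorem max (hf : ReluFun m f) (hg : ReluFun m g) : ReluFun m (fun v => max (f v) (g v)) := by
  have h : (fun v => Max.max (f v) (g v)) = fun v => _root_.relu (f v + -g v) + g v := by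
    funext v
    rw [_root_.relu, ← max_add_add_right]
    simp
  rw [h]
  exact (hf.add hg.neg).relu.add hg

theorem min (hf : ReluFun m f) (hg : ReluFun m g) : ReluFun m (fun v => min (f v) (g v)) := by
  simpa [max_neg_neg] using (hf.neg.max hg.neg).neg

theorem sum {ι : Type*} (s : Finset ι) {F : ι → (Fin m → ℝ) → ℝ}
    (hF : ∀ i ∈ s, ReluFun m (F i)) : ReluFun m (fun v => ∑ i ∈ s, F i v) := by
  classical
  induction s using Finset.induction_on with
  | empty => simpa using ReluFun.const 0
  | insert a s ha ih =>
    simp only [Finset.sum_insert ha]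
    exact (hF a (by simp)).add (ih fun i hi => hF i (by simp [hi]))

theorem continuous (hf : ReluFun m f) : Continuous f := by
  induction hf with
  | coord i => exact continuous_apply i
  | const c => exact continuous_const
  | add _ _ h₁ h₂ => exact h₁.add h₂
  | smul c _ h => exact continuous_const.mul h
  | relu _ h => exact h.max continuous_const

/-- A network can be enlarged so that, besides its old outputs, it also computes a given
`ReluFun` of them, both up to a linear read-out. -/
theorem exists_net_extension (ρ : ℝ → ℝ) (hf : ReluFun m f) :
    ∀ {p q : ℕ} {φ : (Fin p → ℝ) → (Fin q → ℝ)}, IsDeepNet ρ _root_.relu φ →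
      ∀ L : (Fin q → ℝ) →ₗ[ℝ] (Fin m → ℝ),
        ∃ (r : ℕ) (ψ : (Fin p → ℝ) → (Fin r → ℝ)) (π : (Fin r → ℝ) →ₗ[ℝ] (Fin q → ℝ))
          (l : (Fin r → ℝ) →ₗ[ℝ] ℝ) (c : ℝ), IsDeepNet ρ _root_.relu ψ ∧
            ∀ x, π (ψ x) = φ x ∧ l (ψ x) + c = f (L (φ x)) := by
  induction hf with
  | coord i =>
    intro p q φ hφ L
    exact ⟨q, φ, LinearMap.id, LinearMap.proj i ∘ₗ L, 0, hφ, fun x => by simp⟩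
  | const c =>
    intro p q φ hφ L
    exact ⟨q, φ, LinearMap.id, 0, c, hφ, fun x => by simp⟩
  | smul a _ ih =>
    intro p q φ hφ L
    obtain ⟨r, ψ, π, l, c, hψ, h⟩ := ih hφ L
    refine ⟨r, ψ, π, a • l, a * c, hψ, fun x => ⟨(h x).1, ?_⟩⟩
    simp only [← (h x).2, LinearMap.smul_apply, smul_eq_mul, mul_add]
  | add _ _ ih₁ ih₂ =>
    intro p q φ hφ L
    obtain ⟨r, ψ, π, l, c, hψ, h⟩ := ih₁ hφ L
    -- The second network is stacked on the first, so `π'` still recovers `ψ`, and with it the first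
    -- summand.
    obtain ⟨r', ψ', π', l', c', hψ', h'⟩ := ih₂ hψ (L ∘ₗ π)
    refine ⟨r', ψ', π ∘ₗ π', l ∘ₗ π' + l', c + c', hψ', fun x => ⟨?_, ?_⟩⟩
    · simp [(h' x).1, (h x).1]
    · have h₂ := (h' x).2
      simp only [LinearMap.comp_apply, (h x).1] at h₂
      simp only [← (h x).2, ← h₂, LinearMap.add_apply, LinearMap.comp_apply, (h' x).1]
      ring
  | relu _ ih =>
    intro p q φ hφ L
    obtain ⟨r, ψ, π, l, c, hψ, h⟩ := ih hφ L
    -- The new layer computes `relu (ψ i)`, `relu (-ψ i)` and `relu (l ψ + c)`; old outputs survive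
    -- because `y = relu y - relu (-y)`. The `Unit` slot keeps the width positive even if `r = 0`.
    let e : (Fin r ⊕ Fin r) ⊕ Unit ≃ Fin (Fintype.card ((Fin r ⊕ Fin r) ⊕ Unit)) :=
      Fintype.equivFin _
    let a : (Fin r ⊕ Fin r) ⊕ Unit → ((Fin r → ℝ) →ₗ[ℝ] ℝ) :=
      Sum.elim (Sum.elim (fun i => LinearMap.proj i) fun i => -LinearMap.proj i) fun _ => l
    let A : (Fin r → ℝ) →ₗ[ℝ] ((Fin r ⊕ Fin r) ⊕ Unit → ℝ) := LinearMap.pi a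
    let b : (Fin r ⊕ Fin r) ⊕ Unit → ℝ := Sum.elim 0 fun _ => c
    let B : ((Fin r ⊕ Fin r) ⊕ Unit → ℝ) →ₗ[ℝ] (Fin r → ℝ) :=
      LinearMap.funLeft ℝ ℝ (fun i => Sum.inl (Sum.inl i)) -
        LinearMap.funLeft ℝ ℝ (fun i => Sum.inl (Sum.inr i))
    have h₁ := hψ.linearMap_comp (LinearMap.funLeft ℝ ℝ e.symm ∘ₗ A) (b ∘ e.symm)
    have h₂ := h₁.layer_linearMap (Fintype.card_pos) (Or.inr rfl) LinearMap.id 0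
    refine ⟨_, _, π ∘ₗ B ∘ₗ LinearMap.funLeft ℝ ℝ e,
      LinearMap.proj (e (Sum.inr ())), 0, h₂, fun x => ⟨?_, ?_⟩⟩
    · rw [← (h x).1]
      simp only [LinearMap.comp_apply]
      congr 1
      funext i
      have hi : _root_.relu (ψ x i) - _root_.relu (-ψ x i) = ψ x i := by
        simp only [_root_.relu]
        rcases le_total (ψ x i) 0 with hx | hx
        · rw [max_eq_right hx, max_eq_left (by linarith)]; ring
        · rw [max_eq_left hx, max_eq_right (by linarith)]; ring
      simpa [B, A, a, b, LinearMap.funLeft_apply] using hi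
    · simp only [← (h x).2]
      simp [A, a, b, LinearMap.funLeft_apply]

theorem exists_isDeepNet (ρ : ℝ → ℝ) (hf : ReluFun m f) :
    ∃ φ : (Fin m → ℝ) → (Fin 1 → ℝ), IsDeepNet ρ _root_.relu φ ∧ ∀ v, φ v 0 = f v := by
  have hid : IsDeepNet ρ _root_.relu (fun v : Fin m → ℝ => v) := by
    simpa using IsDeepNet.affine (ρ₁ := ρ) (ρ₂ := _root_.relu) (1 : Matrix (Fin m) (Fin m) ℝ) 0
  obtain ⟨r, ψ, π, l, c, hψ, h⟩ := hf.exists_net_extension ρ hid LinearMap.id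
  refine ⟨_, hψ.linearMap_comp (LinearMap.pi fun _ => l) (fun _ => c), fun v => ?_⟩
  simpa using (h v).2

end ReluFun

/-! ### Approximation of scalar functions -/

/-- Density on compacta of the `ReluFun`s, by the lattice form of the Stone-Weierstrass theorem. -/
theorem exists_reluFun_approx {X : Type*} [TopologicalSpace X] [CompactSpace X] {m : ℕ}
    (ι : C(X, Fin m → ℝ)) (hι : Function.Injective ι) (f : C(X, ℝ)) {δ : ℝ} (hδ : 0 < δ) :
    ∃ g, ReluFun m g ∧ ∀ x, |g (ι x) - f x| < δ := by
  let L : Set C(X, ℝ) := {u | ∃ g, ReluFun m g ∧ ∀ x, u x = g (ι x)}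
  have hL : closure L = ⊤ := by
    apply ContinuousMap.sublattice_closure_eq_top
    · exact ⟨0, _, ReluFun.const 0, fun x => rfl⟩
    · rintro u ⟨g, hg, hu⟩ v ⟨g', hg', hv⟩
      exact ⟨_, hg.min hg', fun x => by simp [hu, hv]⟩
    · rintro u ⟨g, hg, hu⟩ v ⟨g', hg', hv⟩
      exact ⟨_, hg.max hg', fun x => by simp [hu, hv]⟩
    · intro v x y
      by_cases hxy : x = y
      · subst hxy
        exact ⟨ContinuousMap.const X (v x), ⟨_, ReluFun.const (v x), fun _ => rfl⟩, rfl, rfl⟩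
      · obtain ⟨i, hi⟩ := Function.ne_iff.mp (hι.ne hxy)
        have hi' : ι y i - ι x i ≠ 0 := sub_ne_zero.mpr (Ne.symm hi)
        -- Affine interpolation of two prescribed values along a coordinate separating the points.
        have hg : ReluFun m fun w => v x + (v y - v x) / (ι y i - ι x i) * (w i + -ι x i) :=
          (ReluFun.const _).add (((ReluFun.coord i).add (ReluFun.const _)).smul _)
        refine ⟨⟨_, hg.continuous.comp ι.continuous⟩, ⟨_, hg, fun _ => rfl⟩, ?_, ?_⟩
        · simp
        · simp only [ContinuousMap.coe_mk, Function.comp_apply]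
          field_simp
          ring
  have hf : f ∈ closure L := by rw [hL]; trivial
  obtain ⟨u, ⟨g, hg, hu⟩, hd⟩ := Metric.mem_closure_iff.mp hf δ hδ
  refine ⟨g, hg, fun x => ?_⟩
  rw [← hu, ← Real.dist_eq, dist_comm]
  exact (ContinuousMap.dist_apply_le_dist x).trans_lt hd

/-- The Euclidean norm is approximated from below, uniformly on compacta, by a maximum of finitely
many linear functionals. -/
theorem exists_reluFun_le_norm {k : ℕ} {K : Set (EuclideanSpace ℝ (Fin k))} (hK : IsCompact K)
    {δ : ℝ} (hδ : 0 < δ) :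
    ∃ p, ReluFun (k + 1) p ∧
      (∀ (t : ℝ) (x : EuclideanSpace ℝ (Fin k)),
        0 ≤ p (Fin.cons t fun l => x l) ∧ p (Fin.cons t fun l => x l) ≤ ‖x‖) ∧
      ∀ (t : ℝ), ∀ x ∈ K, ‖x‖ - δ ≤ p (Fin.cons t fun l => x l) := by
  refine hK.induction_on ?_ ?_ ?_ ?_
  · exact ⟨_, ReluFun.const 0, fun t x => by simp, by simp⟩
  · rintro s t hst ⟨p, hp, h₁, h₂⟩
    exact ⟨p, hp, h₁, fun t x hx => h₂ t x (hst hx)⟩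
  · rintro s s' ⟨p, hp, h₁, h₂⟩ ⟨p', hp', h₁', h₂'⟩
    refine ⟨_, hp.max hp', fun t x => ⟨le_max_of_le_left (h₁ t x).1,
      max_le (h₁ t x).2 (h₁' t x).2⟩, ?_⟩
    rintro t x (hx | hx)
    · exact le_max_of_le_left (h₂ t x hx)
    · exact le_max_of_le_right (h₂' t x hx)
  · intro y _
    -- `u = y / |y|` gives a functional below the norm and equal to it at `y`, hence within `δ` near
    -- `y`; compactness leaves finitely many.
    obtain ⟨u, hu, huy⟩ : ∃ u : EuclideanSpace ℝ (Fin k), ‖u‖ ≤ 1 ∧ inner ℝ u y = ‖y‖ := by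
      rcases eq_or_ne y 0 with rfl | hy0
      · exact ⟨0, by simp, by simp⟩
      · have hn : ‖y‖ ≠ 0 := norm_ne_zero_iff.mpr hy0
        refine ⟨‖y‖⁻¹ • y, by rw [norm_smul]; simp [hn], ?_⟩
        rw [real_inner_smul_left, real_inner_self_eq_norm_sq]
        field_simp
    have hsum : ReluFun (k + 1) fun v => ∑ l : Fin k, u l * v l.succ :=
      ReluFun.sum _ fun l _ => (ReluFun.coord l.succ).smul (u l)
    have hin : ∀ (t : ℝ) (x : EuclideanSpace ℝ (Fin k)),
        ∑ l : Fin k, u l * (Fin.cons t (fun l => x l) : Fin (k + 1) → ℝ) l.succ =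
          inner ℝ u x := by
      intro t x
      simp [PiLp.inner_apply, mul_comm]
    have hcont : Continuous fun x : EuclideanSpace ℝ (Fin k) => ‖x‖ - inner ℝ u x := by fun_prop
    have hev : ∀ᶠ x in 𝓝 y, ‖x‖ - inner ℝ u x < δ :=
      hcont.continuousAt.eventually_lt continuousAt_const (by simpa [huy] using hδ)
    refine ⟨_, mem_nhdsWithin_of_mem_nhds hev, _, hsum.max (ReluFun.const 0), ?_, ?_⟩
    · intro t x
      rw [hin]
      refine ⟨le_max_right _ _, max_le ?_ (norm_nonneg x)⟩
      exact (real_inner_le_norm u x).trans (mul_le_of_le_one_left (norm_nonneg x) hu)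
    · intro t x hx
      rw [hin]
      have hx' : ‖x‖ - inner ℝ u x < δ := hx
      exact le_max_of_le_left (by linarith)

/-- Scalar functions of linear growth are approximated by `ReluFun`s of linear growth. -/
theorem exists_reluFun_approx_linear_growth {T : ℝ} {k : ℕ}
    (f : C(Set.Icc (0 : ℝ) T × EuclideanSpace ℝ (Fin k), ℝ)) {C : ℝ} (hC : 0 < C)
    (hf : ∀ t x, |f (t, x)| ≤ C * (1 + ‖x‖)) {K : Set (EuclideanSpace ℝ (Fin k))}
    (hK : IsCompact K) {ε : ℝ} (hε : 0 < ε) :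
    ∃ g, ReluFun (k + 1) g ∧
      (∀ (t : Set.Icc (0 : ℝ) T), ∀ x ∈ K,
        |g (Fin.cons (t : ℝ) fun l => x l) - f (t, x)| ≤ ε) ∧
      ∀ (t : ℝ) (x : EuclideanSpace ℝ (Fin k)),
        |g (Fin.cons t fun l => x l)| ≤ (1 + C) * (1 + ‖x‖) := by
  have : CompactSpace K := isCompact_iff_compactSpace.mp hK
  let ι : C(Set.Icc (0 : ℝ) T × K, Fin (k + 1) → ℝ) :=
    ⟨fun z => Fin.cons (z.1 : ℝ) fun l => (z.2 : EuclideanSpace ℝ (Fin k)) l, by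
      refine continuous_pi fun i => ?_
      refine Fin.cases ?_ (fun l => ?_) i
      · simp only [Fin.cons_zero]; fun_prop
      · simp only [Fin.cons_succ]; fun_prop⟩
  have hι : Function.Injective ι := by
    rintro ⟨t, x⟩ ⟨s, y⟩ h
    refine Prod.ext (Subtype.ext (congrFun h 0)) (Subtype.ext ?_)
    ext l
    exact congrFun h l.succ
  let F : C(Set.Icc (0 : ℝ) T × K, ℝ) := f.comp ⟨fun z => (z.1, (z.2 : _)), by fun_prop⟩
  obtain ⟨g, hg, hgf⟩ := exists_reluFun_approx ι hι F (lt_min hε one_half_pos)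
  -- The `+ 1` in the clamp pays for the error `1/2` of `g` and for `C δ = 1/2` lost in replacing
  -- `|x|` by `p`.
  obtain ⟨p, hp, hp₁, hp₂⟩ := exists_reluFun_le_norm hK (δ := 1 / (2 * C)) (by positivity)
  have hh : ReluFun (k + 1) fun v => C * (1 + p v) + 1 :=
    (((ReluFun.const 1).add hp).smul C).add (ReluFun.const 1)
  refine ⟨_, (hg.min hh).max hh.neg, fun t x hx => ?_, fun t x => ?_⟩
  · have h₁ : |g (Fin.cons (t : ℝ) fun l => x l) - f (t, x)| < min ε (1 / 2) := hgf (t, ⟨x, hx⟩)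
    have h₂ := abs_le.mp (hf t x)
    have h₃ := mul_le_mul_of_nonneg_left (hp₂ t x hx) hC.le
    have h₄ : C * (1 / (2 * C)) = 1 / 2 := by field_simp
    have h₅ := abs_lt.mp (h₁.trans_le (min_le_right _ _))
    rw [min_eq_left (by linarith), max_eq_left (by linarith)]
    exact (h₁.trans_le (min_le_left _ _)).le
  · have h₁ := (hp₁ t x).1
    have h₂ := mul_le_mul_of_nonneg_left (hp₁ t x).2 hC.le
    have h₃ : 0 ≤ C * p (Fin.cons t fun l => x l) := by positivity
    have h₄ := norm_nonneg x
    rw [abs_le]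
    constructor
    · exact le_max_of_le_right (by linarith)
    · exact max_le ((min_le_right _ _).trans (by linarith)) (by linarith)

/-! ### The Frobenius norm -/

theorem abs_entry_le_frobenius_norm {n₁ n₂ : ℕ} (M : Matrix (Fin n₁) (Fin n₂) ℝ)
    (i : Fin n₁) (j : Fin n₂) : |M i j| ≤ ‖M‖ := by
  rw [Matrix.frobenius_norm_def, ← Real.sqrt_eq_rpow]
  apply Real.abs_le_sqrt
  have h₁ := Finset.single_le_sum (f := fun j => ‖M i j‖ ^ (2 : ℝ))
    (fun j _ => by positivity) (Finset.mem_univ j)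
  have h₂ := Finset.single_le_sum (f := fun i => ∑ j, ‖M i j‖ ^ (2 : ℝ))
    (fun i _ => by positivity) (Finset.mem_univ i)
  have h₃ := h₁.trans h₂
  simpa using h₃

theorem frobenius_norm_le_of_abs_entry_le {n₁ n₂ : ℕ} {M : Matrix (Fin n₁) (Fin n₂) ℝ} {c : ℝ}
    (hc : 0 ≤ c) (hM : ∀ i j, |M i j| ≤ c) : ‖M‖ ≤ √((n₁ : ℝ) * (n₂ : ℝ)) * c := by
  rw [Matrix.frobenius_norm_def, ← Real.sqrt_eq_rpow]
  apply Real.sqrt_le_iff.mpr ⟨by positivity, ?_⟩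
  rw [mul_pow, Real.sq_sqrt (by positivity)]
  calc ∑ i, ∑ j, ‖M i j‖ ^ (2 : ℝ) ≤ ∑ _i : Fin n₁, ∑ _j : Fin n₂, c ^ 2 := by
        gcongr with i _ j _
        simpa using pow_le_pow_left₀ (abs_nonneg _) (hM i j) 2
    _ = n₁ * n₂ * c ^ 2 := by simp [mul_assoc]

/-! ### The universal approximation property -/

theorem approximableWith_deepNets_relu (ρ : ℝ → ℝ) {T : ℝ} {k n₁ n₂ : ℕ}
    (f : TimeSpaceFun T k n₁ n₂) {C : ℝ} (hC : 0 < C) (hf : LinearGrowth f C) :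
    ApproximableWith (deepNets ρ relu T k n₁ n₂) f (√((n₁ : ℝ) * (n₂ : ℝ)) * (1 + C)) := by
  intro ε hε _ K hK
  set s : ℝ := √((n₁ : ℝ) * (n₂ : ℝ))
  have hs : 0 ≤ s := Real.sqrt_nonneg _
  -- Dividing by `1 + s` rather than `s` also covers empty matrices, where `s = 0`.
  have hentry : ∀ i j, ∃ g, ReluFun (k + 1) g ∧
      (∀ (t : Set.Icc (0 : ℝ) T), ∀ x ∈ K,
        |g (Fin.cons (t : ℝ) fun l => x l) - f (t, x) i j| ≤ ε / (1 + s)) ∧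
      ∀ (t : ℝ) (x : EuclideanSpace ℝ (Fin k)),
        |g (Fin.cons t fun l => x l)| ≤ (1 + C) * (1 + ‖x‖) := fun i j =>
    exists_reluFun_approx_linear_growth ⟨fun z => f z i j, f.continuous.matrix_elem i j⟩ hC
      (fun t x => (abs_entry_le_frobenius_norm _ i j).trans (hf t x)) hK (by positivity)
  choose g hg hgf hgrowth using hentry
  let φ : TimeSpaceFun T k n₁ n₂ :=
    ⟨fun z => Matrix.of fun i j => g i j (Fin.cons (z.1 : ℝ) fun l => z.2 l), by
      refine continuous_matrix fun i j => (hg i j).continuous.comp (continuous_pi fun l => ?_)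
      refine Fin.cases ?_ (fun l => ?_) l
      · simp only [Fin.cons_zero]; fun_prop
      · simp only [Fin.cons_succ]; fun_prop⟩
  refine ⟨φ, fun i j => ?_, fun t x hx => ?_, fun t x => ?_⟩
  · obtain ⟨ψ, hψ, h⟩ := (hg i j).exists_isDeepNet ρ
    exact ⟨ψ, hψ, fun t x => (h _).symm⟩
  · refine (frobenius_norm_le_of_abs_entry_le (c := ε / (1 + s)) (by positivity)
      fun i j => hgf i j t x hx).trans ?_
    rw [← mul_div_assoc, div_le_iff₀ (by positivity)]
    nlinarith
  · rw [mul_assoc]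
    exact frobenius_norm_le_of_abs_entry_le (by positivity) fun i j => hgrowth i j t x

theorem ApproximableWith.mono {T : ℝ} {k n₁ n₂ : ℕ} {N : Set (TimeSpaceFun T k n₁ n₂)}
    {f : TimeSpaceFun T k n₁ n₂} {C C' : ℝ} (h : ApproximableWith N f C) (hC : C ≤ C') :
    ApproximableWith N f C' := by
  intro ε hε hε' K hK
  obtain ⟨φ, hφ, h₁, h₂⟩ := h ε hε hε' K hK
  exact ⟨φ, hφ, h₁, fun t x => (h₂ t x).trans (by gcongr)⟩

theorem mainTheorem4 (T : ℝ) (hT : 0 < T) (k n₁ n₂ : ℕ) (ρ₁ : ℝ → ℝ) (hcont : Continuous ρ₁)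
    (hnonaffine : ¬ ∃ a b : ℝ, ∀ x, ρ₁ x = a * x + b)
    (hC1 : ∃ x₀ : ℝ, (∀ᶠ x in 𝓝 x₀, DifferentiableAt ℝ ρ₁ x) ∧ ContinuousAt (deriv ρ₁) x₀ ∧
      deriv ρ₁ x₀ ≠ 0) :
    UniversalApproximationLG (deepNets ρ₁ relu T k n₁ n₂) ∧
      ∀ (f : TimeSpaceFun T k n₁ n₂) (Cf : ℝ), 0 < Cf → LinearGrowth f Cf →
        ApproximableWith (deepNets ρ₁ relu T k n₁ n₂) f
          (√((n₁ : ℝ) * (n₂ : ℝ)) * (1 + T) * (1 + Cf)) := by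
  constructor
  · rintro f ⟨C, hC, hf⟩
    -- The `+ 1` keeps the constant positive when `n₁ n₂ = 0`.
    exact ⟨√((n₁ : ℝ) * (n₂ : ℝ)) * (1 + C) + 1, by positivity,
      (approximableWith_deepNets_relu ρ₁ f hC hf).mono (by linarith)⟩
  · intro f C hC hf
    refine (approximableWith_deepNets_relu ρ₁ f hC hf).mono ?_
    gcongr
    exact le_mul_of_one_le_right (Real.sqrt_nonneg _) (by linarith)
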